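/- **Setting.** Inputs and outputs are binary. For parties $k\neq l$, a bipartite Bell expression is a real linear functional $\sum_{x,y,a,b} w_{xyab}\,p(ab|xy)$. Given projective measurements $\{\tilde P^{(k)}_{a|x}\}_a$, $\{\tilde P^{(l)}_{b|y}\}_b$, its Bell operator is $\sum_{x,y,a,b} w_{xyab}\,\tilde P^{(k)}_{a|x}\tilde P^{(l)}_{b|y}$. **Expanded Bell expression.** Let $C=(c_{k,l})$ be the $N\times N$ matrix with $c_{k,N}=1$ for $k<N$ and all other entries $0$, and suppose $C\neq 0$ (that is, $N\ge 2$). For each $k<N$, let $\{I^{(k,N)}_{\mu}\}_\mu$ be bipartite Bell expressions between parties $k$ and $N$, indexed by the outcomes $\mu\in\{0,1\}^{N-2}$ of the other parties. For fixed $k$ they are equivalent up to output relabellings. They all have the same local bound $\eta^{\mathrm L}$ and the same maximum quantum value $\eta^{\mathrm Q}$, with $\eta^{\mathrm L}<\eta^{\mathrm Q}$. Put $$I=\sum_{k=1}^{N-1}\sum_{\mu}\tilde P^{\overline{(k,N)}}_{\mu|0}\,I^{(k,N)}_{\mu},\qquad \tilde P^{\overline{(k,N)}}_{\mu|0}=\prod_{k'\ne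 k,N}\tilde P^{(k')}_{\mu_{k'}|0},\qquad \eta_N^{\mathrm Q}=\sum_{k,l}c_{k,l}\,\eta^{\mathrm Q}=(N-1)\eta^{\mathrm Q}.$$ **Hypothesis.** There is an entangled pure two-qubit state $|\Phi\rangle$ such that for every $k<N$ and every $\mu$: 1. The shifted operator $\eta^{\mathrm Q}\mathbb 1-I^{(k,N)}_\mu$ admits a sum-of-squares decomposition $\sum_i M_i^\dagger M_i$, with $M_i$ polynomials in the measurement projectors of parties $k$ and $N$. 2. The inequality $\langle I^{(k,N)}_\mu\rangle\le\eta^{\mathrm Q}$ self-tests $|\Phi\rangle$ together with some projective qubit measurements $P^{(k)}_{a|x},P^{(N)}_{b|y}$. That is, for all Hilbert spaces, all projective measurements and every unit vector $|\Psi\rangle\in\mathcal H_{\tilde Q_k}\otimes\mathcal H_{\tilde Q_N}\otimes\mathcal H_E$ with $\langle I^{(k,N)}_\mu\rangle=\eta^{\mathrm Q}$, there are a local isometry $V:\mathcal H_{\tilde Q_k}\otimes\mathcal H_{\tilde Q_N}\otimes\mathcal H_E\to\mathcal H_{Q_k}\otimes\mathcal H_{Q_N}\otimes\mathcal H_{\mathrm{Junk}}$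 and a unit vector $|\xi\rangle\in\mathcal H_{\mathrm{Junk}}$ with $$V\big(\tilde P^{(k)}_{a|x}\otimes\tilde P^{(N)}_{b|y}\otimes\mathbb 1_E\big)|\Psi\rangle=\big(P^{(k)}_{a|x}\otimes P^{(N)}_{b|y}\big)|\Phi\rangle\otimes|\xi\rangle\qquad\text{for all }a,b,x,y.$$ 3. These qubit measurements satisfy $\langle\Phi|P^{(k)}_{a|0}\otimes P^{(N)}_{b|0}|\Phi\rangle>0$ for all $a,b$. Here *local* means that $V=V_k\otimes V_N\otimes V_E$ with isometries $V_k:\mathcal H_{\tilde Q_k}\to\mathcal H_{Q_k}\otimes\mathcal H_{J_k}$, $V_N:\mathcal H_{\tilde Q_N}\to\mathcal H_{Q_N}\otimes\mathcal H_{J_N}$, $V_E:\mathcal H_E\to\mathcal H_{J_E}$ and $\mathcal H_{\mathrm{Junk}}=\mathcal H_{J_k}\otimes\mathcal H_{J_N}\otimes\mathcal H_{J_E}$. **Conclusion.** Let $|\Psi\rangle\in\bigotimes_{k=1}^N\mathcal H_{\tilde Q_k}\otimes\mathcal H_E$ be a unit vector and $\{\tilde P^{(k)}_{a_k|x_k}\}_{a_k}$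 projective measurements on $\mathcal H_{\tilde Q_k}$ (Hilbert spaces of arbitrary dimension) such that $\langle I\rangle=\eta_N^{\mathrm Q}$. Then the post-measurement state for the inputs $\mathbf x=\mathbf 0$, $$\rho_{\mathbf RE|\mathbf 0}=\sum_{\mathbf a}|\mathbf a\rangle\langle\mathbf a|_{\mathbf R}\otimes\mathrm{Tr}_{\tilde{\mathbf Q}}\Big[\Big(\bigotimes_{k}\tilde P^{(k)}_{a_k|0}\otimes\mathbb 1_E\Big)|\Psi\rangle\langle\Psi|\Big],$$ satisfies $\rho_{\mathbf RE|\mathbf 0}=\rho_{\mathbf R|\mathbf 0}\otimes\rho_E$, where $\rho_{\mathbf R|\mathbf 0}=\mathrm{Tr}_E\,\rho_{\mathbf RE|\mathbf 0}$ and $\rho_E=\mathrm{Tr}_{\tilde{\mathbf Q}}|\Psi\rangle\langle\Psi|$. -/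

import Mathlib

open scoped Kronecker ComplexOrder

noncomputable section

namespace DIBell

/-! ### Hilbert spaces, tensor products and local operators

Up to a choice of orthonormal basis, every complex Hilbert space is `ℓ²(ι)` for some index type `ι`,
and the Hilbert space tensor product of `ℓ²(ι)` and `ℓ²(κ)` is `ℓ²(ι × κ)`. No restriction on the
dimension is made. -/

/-- The complex Hilbert space with an orthonormal basis indexed by `ι`. -/
abbrev Hilb (ι : Type) : Type := lp (fun _ : ι => ℂ) 2

theorem summable_sq {ι : Type} (ψ : Hilb ι) : Summable fun i => ‖ψ i‖ ^ 2 := by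
  have h := (memℓp_gen_iff (p := 2) (by norm_num)).1 (lp.memℓp ψ)
  simpa using h

theorem norm_sq_eq {ι : Type} (ψ : Hilb ι) : ‖ψ‖ ^ 2 = ∑' i, ‖ψ i‖ ^ 2 := by
  have h := lp.norm_rpow_eq_tsum (p := 2) (by norm_num) ψ
  simpa using h

theorem memℓp_of_summable_sq {ι : Type} {f : ι → ℂ} (h : Summable fun i => ‖f i‖ ^ 2) :
    Memℓp f 2 :=
  (memℓp_gen_iff (p := 2) (by norm_num)).2 (by simpa using h)

variable {ι ι' κ K K' : Type}

/-- For `K ≃ ι × κ` and `ψ ∈ ℓ²(K) = ℓ²(ι) ⊗ ℓ²(κ)`, the vector of `ℓ²(ι)` that stands in front of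
the `j`-th basis vector of `ℓ²(κ)`. -/
def slice (e : K ≃ ι × κ) (j : κ) (ψ : Hilb K) : Hilb ι :=
  ⟨fun i => ψ (e.symm (i, j)), memℓp_of_summable_sq <|
    (summable_sq ψ).comp_injective (i := fun i => e.symm (i, j)) fun a b h => by simpa using h⟩

theorem summable_norm_slice (e : K ≃ ι × κ) (ψ : Hilb K) :
    Summable fun j => ‖slice e j ψ‖ ^ 2 := by
  have h : Summable fun p : κ × ι => ‖ψ (e.symm (p.2, p.1))‖ ^ 2 :=
    (summable_sq ψ).comp_injective (i := fun p : κ × ι => e.symm (p.2, p.1)) fun a b h => by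
      simpa [Prod.ext_iff, and_comm] using h
  simpa [norm_sq_eq, slice] using h.prod

theorem tsum_norm_slice (e : K ≃ ι × κ) (ψ : Hilb K) :
    ∑' j, ‖slice e j ψ‖ ^ 2 = ‖ψ‖ ^ 2 := by
  have h : Summable fun p : κ × ι => ‖ψ (e.symm (p.2, p.1))‖ ^ 2 :=
    (summable_sq ψ).comp_injective (i := fun p : κ × ι => e.symm (p.2, p.1)) fun a b h => by
      simpa [Prod.ext_iff, and_comm] using h
  rw [norm_sq_eq ψ, ← ((Equiv.prodComm κ ι).trans e.symm).tsum_eq fun k => ‖ψ k‖ ^ 2]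
  simp only [norm_sq_eq]
  exact (h.tsum_prod).symm

/-- The coordinates of `(T ⊗ 1) ψ`. -/
def tensorIdFun (e : K ≃ ι × κ) (e' : K' ≃ ι' × κ) (T : Hilb ι →L[ℂ] Hilb ι') (ψ : Hilb K) :
    K' → ℂ :=
  fun k => T (slice e (e' k).2 ψ) (e' k).1

theorem summable_tensorIdFun (e : K ≃ ι × κ) (T : Hilb ι →L[ℂ] Hilb ι')
    (ψ : Hilb K) : Summable fun p : κ × ι' => ‖T (slice e p.1 ψ) p.2‖ ^ 2 := by
  refine (summable_prod_of_nonneg fun p => by positivity).2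
    ⟨fun j => summable_sq (T (slice e j ψ)), ?_⟩
  simp only [← norm_sq_eq]
  refine Summable.of_nonneg_of_le (fun j => by positivity) (fun j => ?_)
    ((summable_norm_slice e ψ).mul_left (‖T‖ ^ 2))
  rw [← mul_pow]
  exact pow_le_pow_left₀ (norm_nonneg _) (T.le_opNorm _) 2

theorem memℓp_tensorIdFun (e : K ≃ ι × κ) (e' : K' ≃ ι' × κ) (T : Hilb ι →L[ℂ] Hilb ι')
    (ψ : Hilb K) : Memℓp (tensorIdFun e e' T ψ) 2 := by
  refine memℓp_of_summable_sq ?_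
  have h := (summable_tensorIdFun e T ψ).comp_injective
    (i := fun k => ((e' k).2, (e' k).1)) fun a b h => by
      refine e'.injective (Prod.ext ?_ ?_)
      · exact congrArg Prod.snd h
      · exact congrArg Prod.fst h
  exact h

/-- `T ⊗ 1` as a linear map. -/
def tensorIdLin (e : K ≃ ι × κ) (e' : K' ≃ ι' × κ) (T : Hilb ι →L[ℂ] Hilb ι') :
    Hilb K →ₗ[ℂ] Hilb K' where
  toFun ψ := ⟨tensorIdFun e e' T ψ, memℓp_tensorIdFun e e' T ψ⟩
  map_add' ψ φ := by
    ext k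
    have h : slice e (e' k).2 (ψ + φ) = slice e (e' k).2 ψ + slice e (e' k).2 φ := rfl
    change T (slice e (e' k).2 (ψ + φ)) (e' k).1 =
      T (slice e (e' k).2 ψ) (e' k).1 + T (slice e (e' k).2 φ) (e' k).1
    rw [h, map_add]
    rfl
  map_smul' c ψ := by
    ext k
    have h : slice e (e' k).2 (c • ψ) = c • slice e (e' k).2 ψ := rfl
    change T (slice e (e' k).2 (c • ψ)) (e' k).1 = c * T (slice e (e' k).2 ψ) (e' k).1
    rw [h, map_smul]
    rfl

theorem norm_tensorIdLin_le (e : K ≃ ι × κ) (e' : K' ≃ ι' × κ) (T : Hilb ι →L[ℂ] Hilb ι')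
    (ψ : Hilb K) : ‖tensorIdLin e e' T ψ‖ ≤ ‖T‖ * ‖ψ‖ := by
  refine le_of_sq_le_sq ?_ (by positivity)
  have h := summable_tensorIdFun e T ψ
  have h2 : ∀ j, ∑' i, ‖T (slice e j ψ) i‖ ^ 2 = ‖T (slice e j ψ)‖ ^ 2 :=
    fun j => (norm_sq_eq _).symm
  have h3 : ∀ p : κ × ι', ‖tensorIdLin e e' T ψ (((Equiv.prodComm κ ι').trans e'.symm) p)‖ ^ 2 =
      ‖T (slice e p.1 ψ) p.2‖ ^ 2 := by
    intro p
    change ‖T (slice e (e' (e'.symm (p.2, p.1))).2 ψ) (e' (e'.symm (p.2, p.1))).1‖ ^ 2 = _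
    rw [Equiv.apply_symm_apply]
  rw [norm_sq_eq, mul_pow, ← tsum_norm_slice e ψ, ← tsum_mul_left,
    ← ((Equiv.prodComm κ ι').trans e'.symm).tsum_eq]
  simp only [h3]
  rw [h.tsum_prod]
  simp only [h2]
  refine Summable.tsum_le_tsum (fun j => ?_) ?_ ((summable_norm_slice e ψ).mul_left _)
  · rw [← mul_pow]
    exact pow_le_pow_left₀ (norm_nonneg _) (T.le_opNorm _) 2
  · simpa [h2] using h.prod

/-- The operator `T ⊗ 1` from `ℓ²(K) = ℓ²(ι) ⊗ ℓ²(κ)` to `ℓ²(K') = ℓ²(ι') ⊗ ℓ²(κ)`, where the two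
factorisations are given by `e : K ≃ ι × κ` and `e' : K' ≃ ι' × κ`. -/
def tensorId (e : K ≃ ι × κ) (e' : K' ≃ ι' × κ) (T : Hilb ι →L[ℂ] Hilb ι') :
    Hilb K →L[ℂ] Hilb K' :=
  LinearMap.mkContinuous (tensorIdLin e e' T) ‖T‖ (norm_tensorIdLin_le e e' T)

@[simp] theorem tensorId_apply (e : K ≃ ι × κ) (e' : K' ≃ ι' × κ) (T : Hilb ι →L[ℂ] Hilb ι')
    (ψ : Hilb K) (k : K') : tensorId e e' T ψ k = T (slice e (e' k).2 ψ) (e' k).1 := rfl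

/-- The real expectation value `⟨ψ| O |ψ⟩` of an observable. -/
def expectation (O : Hilb K →L[ℂ] Hilb K) (ψ : Hilb K) : ℝ := (inner ℂ ψ (O ψ)).re

/-- The operator `T ⊗ 1` on `ℓ²(ι) ⊗ ℓ²(κ)`. -/
def onLeft (T : Hilb ι →L[ℂ] Hilb ι) : Hilb (ι × κ) →L[ℂ] Hilb (ι × κ) :=
  tensorId (Equiv.refl _) (Equiv.refl _) T

/-- The operator `1 ⊗ T` on `ℓ²(κ) ⊗ ℓ²(ι)`. -/
def onRight (T : Hilb ι →L[ℂ] Hilb ι) : Hilb (κ × ι) →L[ℂ] Hilb (κ × ι) :=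
  tensorId (Equiv.prodComm _ _) (Equiv.prodComm _ _) T

/-- Singling out the second of three tensor factors. -/
def secondOfThree (α β γ : Type) : α × β × γ ≃ β × (α × γ) where
  toFun t := (t.2.1, (t.1, t.2.2))
  invFun t := (t.2.1, t.1, t.2.2)

/-- Singling out the last of three tensor factors. -/
def thirdOfThree (α β γ : Type) : α × β × γ ≃ γ × (α × β) where
  toFun t := (t.2.2, (t.1, t.2.1))
  invFun t := (t.2.1, t.2.2, t.1)

/-- The operator `V₁ ⊗ V₂ ⊗ V₃` on a threefold tensor product. -/
def tensorThree {α β γ α' β' γ' : Type} (V₁ : Hilb α →L[ℂ] Hilb α') (V₂ : Hilb β →L[ℂ] Hilb β')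
    (V₃ : Hilb γ →L[ℂ] Hilb γ') : Hilb (α × β × γ) →L[ℂ] Hilb (α' × β' × γ') :=
  tensorId (thirdOfThree α' β' γ) (thirdOfThree α' β' γ') V₃ ∘L
    tensorId (secondOfThree α' β γ) (secondOfThree α' β' γ) V₂ ∘L
      tensorId (Equiv.refl (α × β × γ)) (Equiv.refl (α' × β × γ)) V₁

/-! ### Measurements and Bell expressions

All inputs and outputs are binary: `Fin 2`. -/

/-- Binary-input binary-outcome projective measurements on `ℓ²(ι)`: `P x a` is the projector for
input `x` and output `a`. -/
structure Measurements (ι : Type) where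
  P : Fin 2 → Fin 2 → (Hilb ι →L[ℂ] Hilb ι)
  isProj : ∀ x a, IsStarProjection (P x a)
  sum_eq_one : ∀ x, ∑ a, P x a = 1

/-- A bipartite Bell expression `∑ w x y a b * p(a b | x y)`, given by its real coefficients. -/
abbrev BellExpr : Type := Fin 2 → Fin 2 → Fin 2 → Fin 2 → ℝ

/-- The value of a Bell expression on a behaviour `p x y a b = p(a b | x y)`. -/
def BellExpr.value (w : BellExpr) (p : Fin 2 → Fin 2 → Fin 2 → Fin 2 → ℝ) : ℝ :=
  ∑ x, ∑ y, ∑ a, ∑ b, w x y a b * p x y a b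

/-- The Bell operator `∑ w x y a b • A x a * B y b`, for projectors `A x a` and `B y b` of two
parties, as operators on a common space. -/
def BellExpr.op (w : BellExpr) (A B : Fin 2 → Fin 2 → (Hilb K →L[ℂ] Hilb K)) :
    Hilb K →L[ℂ] Hilb K :=
  ∑ x, ∑ y, ∑ a, ∑ b, (w x y a b : ℂ) • (A x a * B y b)

/-- The deterministic local behaviour with output functions `f` and `g`. -/
def deterministic (f g : Fin 2 → Fin 2) : Fin 2 → Fin 2 → Fin 2 → Fin 2 → ℝ :=
  fun x y a b => if a = f x ∧ b = g y then 1 else 0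

/-- The local polytope. -/
def localBehaviours : Set (Fin 2 → Fin 2 → Fin 2 → Fin 2 → ℝ) :=
  convexHull ℝ {p | ∃ f g, p = deterministic f g}

/-- `η` is the local bound (the maximum local value) of the Bell expression. -/
def IsLocalBound (w : BellExpr) (η : ℝ) : Prop :=
  IsGreatest (w.value '' localBehaviours) η

/-- Two Bell expressions agree after permuting the outputs of each party, for each input. -/
def OutputRelabelling (w w' : BellExpr) : Prop :=
  ∃ σ τ : Fin 2 → Equiv.Perm (Fin 2), ∀ x y a b, w' x y a b = w x y (σ x a) (τ y b)

/-! ### Bipartite strategies, sums of squares, self-testing -/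

/-- A physical strategy for two parties: a state of the two parties in the form of a purification
`Ψ` with a third system `E`, and projective measurements of both parties. -/
structure BipartiteStrategy where
  ιA : Type
  ιB : Type
  ιE : Type
  A : Measurements ιA
  B : Measurements ιB
  Ψ : Hilb (ιA × ιB × ιE)
  norm_eq_one : ‖Ψ‖ = 1

namespace BipartiteStrategy

variable (S : BipartiteStrategy)

/-- The space of the two parties and `E`. -/
abbrev Space : Type := Hilb (S.ιA × S.ιB × S.ιE)

/-- The first party's projector, as an operator on the whole space. -/
def opA (x a : Fin 2) : S.Space →L[ℂ] S.Space :=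
  tensorId (Equiv.refl _) (Equiv.refl _) (S.A.P x a)

/-- The second party's projector, as an operator on the whole space. -/
def opB (y b : Fin 2) : S.Space →L[ℂ] S.Space :=
  tensorId (secondOfThree _ _ _) (secondOfThree _ _ _) (S.B.P y b)

/-- The Bell operator of the strategy. -/
def bellOp (w : BellExpr) : S.Space →L[ℂ] S.Space := w.op S.opA S.opB

/-- The value `⟨I⟩` of the Bell expression. -/
def bellValue (w : BellExpr) : ℝ := expectation (S.bellOp w) S.Ψ

end BipartiteStrategy

/-- `η` is the maximum quantum value of the Bell expression. -/
def IsMaxQuantumValue (w : BellExpr) (η : ℝ) : Prop :=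
  IsGreatest (Set.range fun S : BipartiteStrategy => S.bellValue w) η

/-- Polynomials in the (noncommuting) projectors of two parties: `Sum.inl (x, a)` stands for the
first party's projector for input `x` and output `a`, `Sum.inr (y, b)` for the second party's. -/
abbrev ProjectorPoly : Type := FreeAlgebra ℂ ((Fin 2 × Fin 2) ⊕ (Fin 2 × Fin 2))

/-- The operator obtained by inserting the projectors of a strategy in a polynomial. -/
def BipartiteStrategy.evalPoly (S : BipartiteStrategy) (M : ProjectorPoly) :
    S.Space →L[ℂ] S.Space :=
  FreeAlgebra.lift ℂ (Sum.elim (fun t => S.opA t.1 t.2) (fun t => S.opB t.1 t.2)) M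

/-- The shifted Bell operator `η • 1 - I` admits a sum-of-squares decomposition: it equals
`∑ i, (M i)† (M i)` for polynomials `M i` in the projectors, the same for all strategies. -/
def AdmitsSOS (w : BellExpr) (η : ℝ) : Prop :=
  ∃ (m : ℕ) (M : Fin m → ProjectorPoly), ∀ S : BipartiteStrategy,
    (η : ℂ) • (1 : S.Space →L[ℂ] S.Space) - S.bellOp w =
      ∑ i, star (S.evalPoly (M i)) * S.evalPoly (M i)

/-- A state of two qubits is entangled: it is not a product vector. -/
def IsEntangled (Φ : Hilb (Fin 2 × Fin 2)) : Prop :=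
  ¬ ∃ u v : Fin 2 → ℂ, ∀ i j, Φ (i, j) = u i * v j

/-- The inequality `⟨I⟩ ≤ η` self-tests the two-qubit state `Φ` and the qubit measurements `PA`,
`PB`: for every strategy with `⟨I⟩ = η` there are local isometries (the third one acts on the
purifying system; the identity is allowed) and a junk state `ξ` such that
`V (P̃_{a|x} ⊗ P̃_{b|y} ⊗ 1) Ψ = (P_{a|x} ⊗ P_{b|y}) Φ ⊗ ξ` for all inputs and outputs. The junk
space is the tensor product of the junk spaces of the two parties and of the purifying system. -/
def SelfTests (w : BellExpr) (η : ℝ) (Φ : Hilb (Fin 2 × Fin 2)) (PA PB : Measurements (Fin 2)) :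
    Prop :=
  ∀ S : BipartiteStrategy, S.bellValue w = η →
    ∃ (JA JB JE : Type) (VA : Hilb S.ιA →ₗᵢ[ℂ] Hilb (Fin 2 × JA))
      (VB : Hilb S.ιB →ₗᵢ[ℂ] Hilb (Fin 2 × JB)) (VE : Hilb S.ιE →ₗᵢ[ℂ] Hilb JE)
      (ξ : Hilb (JA × JB × JE)), ‖ξ‖ = 1 ∧
      ∀ x y a b, ∀ (q : Fin 2) (jA : JA) (q' : Fin 2) (jB : JB) (jE : JE),
        tensorThree VA.toContinuousLinearMap VB.toContinuousLinearMap VE.toContinuousLinearMap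
            (S.opA x a (S.opB y b S.Ψ)) ((q, jA), (q', jB), jE) =
          (onLeft (PA.P x a) (onRight (PB.P y b) Φ)) (q, q') * ξ (jA, jB, jE)

/-! ### Expanded Bell expressions -/

/-- Outcomes of all parties other than `k` and `l`. -/
abbrev OtherOutcomes {N : ℕ} (k l : Fin N) : Type := {j : Fin N // j ≠ k ∧ j ≠ l} → Fin 2

/-- An `N`-party expanded Bell expression with binary inputs and outputs: the matrix `C`, and, for
every pair `k, l` with `C k l ≠ 0`, seeds indexed by the outcomes `μ` of the other parties, which
are equivalent up to output relabellings and have a local bound `ηL` strictly below their maximum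
quantum value `ηQ`. -/
structure ExpandedBell (N : ℕ) where
  C : Matrix (Fin N) (Fin N) ℕ
  C_ne_zero : C ≠ 0
  C_zero_one : ∀ k l, k < l → C k l = 0 ∨ C k l = 1
  C_eq_zero : ∀ k l, ¬ k < l → C k l = 0
  seed : ∀ k l : Fin N, OtherOutcomes k l → BellExpr
  ηL : ℝ
  ηQ : ℝ
  relabel : ∀ k l, C k l ≠ 0 → ∀ μ μ', OutputRelabelling (seed k l μ) (seed k l μ')
  localBound : ∀ k l, C k l ≠ 0 → ∀ μ, IsLocalBound (seed k l μ) ηL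
  quantumBound : ∀ k l, C k l ≠ 0 → ∀ μ, IsMaxQuantumValue (seed k l μ) ηQ
  gap : ηL < ηQ

/-- The bound `η_N = ∑ C k l * ηQ` of the expanded Bell expression. -/
def ExpandedBell.ηN {N : ℕ} (X : ExpandedBell N) : ℝ := ∑ k, ∑ l, (X.C k l : ℝ) * X.ηQ

/-- A quantum strategy for `N` parties and Eve: a pure state of the `N` devices and Eve, and
projective measurements of the `N` devices. -/
structure Strategy (N : ℕ) where
  ι : Fin N → Type
  ιE : Type
  meas : ∀ k, Measurements (ι k)
  Ψ : Hilb ((∀ k, ι k) × ιE)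
  norm_eq_one : ‖Ψ‖ = 1

namespace Strategy

variable {N : ℕ} (S : Strategy N)

/-- The space of the `N` devices and Eve. -/
abbrev Space : Type := Hilb ((∀ k, S.ι k) × S.ιE)

/-- Singling out the tensor factor of party `k`. -/
def split (k : Fin N) :
    (∀ j, S.ι j) × S.ιE ≃ S.ι k × ((∀ j : {j // j ≠ k}, S.ι j) × S.ιE) :=
  ((Equiv.piSplitAt k S.ι).prodCongr (Equiv.refl _)).trans (Equiv.prodAssoc _ _ _)

/-- The projector of party `k` for input `x` and output `a`, as an operator on the whole space. -/
def op (k : Fin N) (x a : Fin 2) : S.Space →L[ℂ] S.Space :=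
  tensorId (S.split k) (S.split k) ((S.meas k).P x a)

/-- The joint projector of all parties for the inputs `x` and the outputs `a`. -/
def jointProj (x a : Fin N → Fin 2) : S.Space →L[ℂ] S.Space :=
  (List.ofFn fun j => S.op j (x j) (a j)).prod

/-- The joint projector of all parties other than `k` and `l`, for inputs `0` and outcomes `μ`. -/
def otherProj (k l : Fin N) (μ : OtherOutcomes k l) : S.Space →L[ℂ] S.Space :=
  (List.ofFn fun j => if h : j ≠ k ∧ j ≠ l then S.op j 0 (μ ⟨j, h⟩) else 1).prod

/-- The expanded Bell operator `I = ∑ C k l • ∑ μ, P_μ * I_μ`. -/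
def bellOp (X : ExpandedBell N) : S.Space →L[ℂ] S.Space :=
  ∑ k, ∑ l, (X.C k l : ℂ) • ∑ μ : OtherOutcomes k l,
    S.otherProj k l μ * (X.seed k l μ).op (S.op k) (S.op l)

/-- The value `⟨I⟩` of the expanded Bell expression. -/
def bellValue (X : ExpandedBell N) : ℝ := expectation (S.bellOp X) S.Ψ

end Strategy

/-! ### Post-measurement states

Operators on `ℓ²(κ)` are written as (possibly infinite) matrices in the standard orthonormal basis.
All series below converge absolutely, since they come from products of two `ℓ²` vectors. -/

/-- Partial trace over the first factor. -/
def traceLeft {m n : Type} (ρ : Matrix (m × n) (m × n) ℂ) : Matrix n n ℂ :=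
  fun e e' => ∑' q, ρ (q, e) (q, e')

/-- Partial trace over the second factor. -/
def traceRight {m n : Type} (ρ : Matrix (m × n) (m × n) ℂ) : Matrix m m ℂ :=
  fun q q' => ∑' e, ρ (q, e) (q', e)

/-- The operator `|φ⟩⟨ψ|`. -/
def ketBra (φ ψ : Hilb K) : Matrix K K ℂ := fun k k' => φ k * star (ψ k')

namespace Strategy

variable {N : ℕ} (S : Strategy N)

/-- Eve's subnormalised state `Tr_Q [(P_{a|x} ⊗ 1) |Ψ⟩⟨Ψ|]`. -/
def rhoEve (a x : Fin N → Fin 2) : Matrix S.ιE S.ιE ℂ :=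
  traceLeft (ketBra (S.jointProj x a S.Ψ) S.Ψ)

/-- The post-measurement classical-quantum state `∑ a, |a⟩⟨a| ⊗ Tr_Q [(P_{a|x} ⊗ 1) |Ψ⟩⟨Ψ|]`. -/
def rhoRE (x : Fin N → Fin 2) :
    Matrix ((Fin N → Fin 2) × S.ιE) ((Fin N → Fin 2) × S.ιE) ℂ :=
  ∑ a, Matrix.single a a (1 : ℂ) ⊗ₖ S.rhoEve a x

/-- The state of the outcome register, the partial trace of the post-measurement state. -/
def rhoR (x : Fin N → Fin 2) : Matrix (Fin N → Fin 2) (Fin N → Fin 2) ℂ :=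
  traceRight (S.rhoRE x)

/-- Eve's reduced state `Tr_Q |Ψ⟩⟨Ψ|`. -/
def rhoE : Matrix S.ιE S.ιE ℂ := traceLeft (ketBra S.Ψ S.Ψ)

end Strategy

end DIBell

end

open DIBell
open scoped Kronecker

/-!
Saturation of the expanded inequality forces every seed to be saturated. For a pair `k, N` and
outcomes `μ` of the other parties, the projector `P_μ` commutes with the Bell operator `I_μ`, so
`⟨P_μ I_μ⟩` is the value of `I_μ` in the vector `P_μ Ψ` and is at most `ηQ ‖P_μ Ψ‖²`. These bounds
sum to `(N - 1) ηQ`, the value attained, so each is an equality (`Strategy.expectation_seed_eq`).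

If `P_μ Ψ ≠ 0`, the normalised vector is therefore a bipartite strategy of `k` and `N`, purified by
all other devices and Eve, to which self-testing applies. The local isometry `V` takes
`P_a P_b P_μ Ψ` to a multiple of `(P_a ⊗ P_b) Φ ⊗ ξ`, and an operator `F` of the purifying system to
`V₃ F V₃†`, which acts on `ξ` only. Hence the state of the purifying system conditioned on `a, b`
depends on `a, b` only through the weight `‖(P_a ⊗ P_b) Φ‖²` (`exists_inner_onThird_eq`), which is
positive by assumption. In particular Eve's unnormalised states for two outcome strings that
differ only at `k` and `N` are positive multiples of each other
(`Strategy.eveProportional_of_selfTests`).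

Letting `k` vary, all outcome strings are connected by such changes, so all of Eve's conditional
states are positive multiples of one of them. They sum to `ρ_E`, hence each is a multiple of `ρ_E`,
which is the claimed product form (`Strategy.rhoRE_eq_of_eveProportional`).

Eve's states are handled through the values `⟨Ψ, (1 ⊗ F) P_a Ψ⟩` that they assign to operators `F`
on her system; the matrix entries are recovered from `F = |e'⟩⟨e|`.
-/

noncomputable section

namespace DIBell

/-! ### Calculus of local operators -/

section TensorId

variable {ι ι' ι'' κ κ' K K' K'' : Type}

@[simp] theorem slice_apply (e : K ≃ ι × κ) (j : κ) (ψ : Hilb K) (i : ι) :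
    slice e j ψ i = ψ (e.symm (i, j)) := rfl

theorem slice_single (e : K ≃ ι × κ) [DecidableEq ι] [DecidableEq κ] [DecidableEq K] (j : κ)
    (k : K) : slice e j (lp.single 2 k (1 : ℂ)) =
      if (e k).2 = j then lp.single 2 (e k).1 (1 : ℂ) else 0 := by
  obtain ⟨⟨i₀, j₀⟩, rfl⟩ := e.symm.surjective k
  ext i
  by_cases h : j₀ = j <;> by_cases h' : i = i₀ <;>
    simp [h, h']

@[simp] theorem slice_tensorId (e : K ≃ ι × κ) (e' : K' ≃ ι' × κ) (T : Hilb ι →L[ℂ] Hilb ι')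
    (j : κ) (ψ : Hilb K) : slice e' j (tensorId e e' T ψ) = T (slice e j ψ) := by
  ext i; simp

theorem tensorId_comp (e : K ≃ ι × κ) (e' : K' ≃ ι' × κ) (e'' : K'' ≃ ι'' × κ)
    (S : Hilb ι' →L[ℂ] Hilb ι'') (T : Hilb ι →L[ℂ] Hilb ι') :
    tensorId e' e'' S ∘L tensorId e e' T = tensorId e e'' (S ∘L T) := by
  ext ψ k; simp

theorem tensorId_one (e : K ≃ ι × κ) : tensorId e e 1 = 1 := by
  ext ψ k; simp

theorem tensorId_mul (e : K ≃ ι × κ) (S T : Hilb ι →L[ℂ] Hilb ι) :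
    tensorId e e (S * T) = tensorId e e S * tensorId e e T :=
  (tensorId_comp e e e S T).symm

theorem tensorId_add (e : K ≃ ι × κ) (e' : K' ≃ ι' × κ) (S T : Hilb ι →L[ℂ] Hilb ι') :
    tensorId e e' (S + T) = tensorId e e' S + tensorId e e' T := by
  ext ψ k; simp

/-- A local operator depends on the factorisation only through the factor on which it acts: the
complementary factor may be relabelled. -/
theorem tensorId_congr (e : K ≃ ι × κ) (e' : K' ≃ ι' × κ) (f : K ≃ ι × κ') (f' : K' ≃ ι' × κ')
    (T : Hilb ι →L[ℂ] Hilb ι') (h₁ : ∀ k, (e' k).1 = (f' k).1)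
    (h₂ : ∀ k i, e.symm (i, (e' k).2) = f.symm (i, (f' k).2)) :
    tensorId e e' T = tensorId f f' T := by
  ext ψ k
  have : slice e (e' k).2 ψ = slice f (f' k).2 ψ := by
    ext i; simp [h₂]
  simp [h₁, this]

theorem inner_eq_tsum_slice (e : K ≃ ι × κ) (ψ φ : Hilb K) :
    inner ℂ ψ φ = ∑' j, inner ℂ (slice e j ψ) (slice e j φ) := by
  let u : κ × ι ≃ K := (Equiv.prodComm κ ι).trans e.symm
  have h : Summable fun p => inner ℂ (ψ (u p)) (φ (u p)) :=
    u.summable_iff.2 (lp.summable_inner ψ φ)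
  calc inner ℂ ψ φ = ∑' p, inner ℂ (ψ (u p)) (φ (u p)) :=
        (lp.inner_eq_tsum ψ φ).trans (u.tsum_eq fun k => inner ℂ (ψ k) (φ k)).symm
    _ = ∑' j, ∑' i, inner ℂ (ψ (u (j, i))) (φ (u (j, i))) := h.tsum_prod
    _ = _ := tsum_congr fun j => (lp.inner_eq_tsum (slice e j ψ) (slice e j φ)).symm

theorem adjoint_tensorId (e : K ≃ ι × κ) (e' : K' ≃ ι' × κ) (T : Hilb ι →L[ℂ] Hilb ι') :
    (tensorId e e' T).adjoint = tensorId e' e T.adjoint := by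
  symm
  rw [ContinuousLinearMap.eq_adjoint_iff]
  intro ψ φ
  have h (j : κ) : inner ℂ (slice e j (tensorId e' e T.adjoint ψ)) (slice e j φ) =
      inner ℂ (slice e' j ψ) (slice e' j (tensorId e e' T φ)) := by
    rw [slice_tensorId, slice_tensorId, ContinuousLinearMap.adjoint_inner_left]
  exact (inner_eq_tsum_slice e _ _).trans ((tsum_congr h).trans (inner_eq_tsum_slice e' _ _).symm)

theorem star_tensorId (e : K ≃ ι × κ) (T : Hilb ι →L[ℂ] Hilb ι) :
    star (tensorId e e T) = tensorId e e (star T) :=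
  adjoint_tensorId e e T

theorem isStarProjection_tensorId (e : K ≃ ι × κ) {T : Hilb ι →L[ℂ] Hilb ι}
    (hT : IsStarProjection T) : IsStarProjection (tensorId e e T) where
  isIdempotentElem := by
    rw [IsIdempotentElem, ← tensorId_mul, hT.isIdempotentElem.eq]
  isSelfAdjoint := by
    rw [IsSelfAdjoint, star_tensorId, hT.isSelfAdjoint.star_eq]

theorem inner_tensorId_isometry (e : K ≃ ι × κ) (e' : K' ≃ ι' × κ) (V : Hilb ι →ₗᵢ[ℂ] Hilb ι')
    (ψ φ : Hilb K) : inner ℂ (tensorId e e' V.toContinuousLinearMap ψ)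
      (tensorId e e' V.toContinuousLinearMap φ) = inner ℂ ψ φ := by
  rw [inner_eq_tsum_slice e, inner_eq_tsum_slice e']
  simp

variable {α α' β β' γ L L' : Type}

/-- Operators on two different tensor factors can be applied in either order. -/
theorem tensorId_comm (g : K ≃ α × β × γ) (g' : K' ≃ α' × β × γ) (h : L ≃ α × β' × γ)
    (h' : L' ≃ α' × β' × γ) (T : Hilb α →L[ℂ] Hilb α') (R : Hilb β →L[ℂ] Hilb β') :
    tensorId (g'.trans (secondOfThree _ _ _)) (h'.trans (secondOfThree _ _ _)) R ∘L
        tensorId g g' T =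
      tensorId h h' T ∘L
        tensorId (g.trans (secondOfThree _ _ _)) (h.trans (secondOfThree _ _ _)) R := by
  classical
  -- By continuity it suffices to compare both sides on basis vectors.
  refine lp.ext_continuousLinearMap (ENNReal.ofNat_ne_top (n := nat_lit 2)) fun k => ?_
  ext l
  obtain ⟨⟨i₀, j₀, m₀⟩, rfl⟩ := g.symm.surjective k
  obtain ⟨⟨i, j, m⟩, rfl⟩ := h'.symm.surjective l
  have h1 : slice (g'.trans (secondOfThree _ _ _)) (i, m)
      (tensorId g g' T (lp.single 2 (g.symm (i₀, j₀, m₀)) (1 : ℂ))) =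
      if m₀ = m then (T (lp.single 2 i₀ 1) i) • lp.single 2 j₀ (1 : ℂ) else 0 := by
    ext j'
    by_cases hm : m₀ = m <;> by_cases hj : j₀ = j' <;>
      simp [secondOfThree, slice_single, hm, hj, eq_comm (a := j')]
  have h2 : slice h (j, m)
      (tensorId (g.trans (secondOfThree _ _ _)) (h.trans (secondOfThree _ _ _)) R
        (lp.single 2 (g.symm (i₀, j₀, m₀)) (1 : ℂ))) =
      if m₀ = m then (R (lp.single 2 j₀ 1) j) • lp.single 2 i₀ (1 : ℂ) else 0 := by
    ext j'
    by_cases hm : m₀ = m <;> by_cases hj : i₀ = j' <;>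
      simp [secondOfThree, slice_single, hm, hj, eq_comm (a := j')]
  have e1 : ((h'.trans (secondOfThree _ _ _)) (h'.symm (i, j, m))) = (j, i, m) := by
    simp [secondOfThree]
  simp only [ContinuousLinearMap.comp_apply, lp.singleContinuousLinearMap_apply, tensorId_apply,
    e1, h1, h2, Equiv.apply_symm_apply]
  by_cases hm : m₀ = m <;> simp [hm, mul_comm]

/-- The unitary that relabels the basis vectors. -/
def reindex (u : K ≃ L) : Hilb K →L[ℂ] Hilb L :=
  tensorId (Equiv.prodPUnit K).symm (u.symm.trans (Equiv.prodPUnit K).symm) 1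

@[simp] theorem reindex_apply (u : K ≃ L) (ψ : Hilb K) (l : L) :
    reindex u ψ l = ψ (u.symm l) := rfl

theorem inner_reindex (u : K ≃ L) (ψ φ : Hilb K) :
    inner ℂ (reindex u ψ) (reindex u φ) = inner ℂ ψ φ :=
  inner_tensorId_isometry _ _ (LinearIsometry.id) ψ φ

theorem norm_reindex (u : K ≃ L) (ψ : Hilb K) : ‖reindex u ψ‖ = ‖ψ‖ := by
  rw [@norm_eq_sqrt_re_inner ℂ, inner_reindex, ← @norm_eq_sqrt_re_inner ℂ]

theorem reindex_tensorId (u : K ≃ L) (e : K ≃ ι × κ) (T : Hilb ι →L[ℂ] Hilb ι) (ψ : Hilb K) :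
    reindex u (tensorId e e T ψ) =
      tensorId (u.symm.trans e) (u.symm.trans e) T (reindex u ψ) := by
  ext l
  have h : slice (u.symm.trans e) (e (u.symm l)).2 (reindex u ψ) = slice e (e (u.symm l)).2 ψ := by
    ext i; simp
  simp [h]

end TensorId

/-! ### Self-testing decouples the third system -/

section SelfTest

variable {α β γ α' β' γ' : Type}

/-- The operator `1 ⊗ 1 ⊗ F` on a threefold tensor product. -/
def onThird (F : Hilb γ →L[ℂ] Hilb γ) : Hilb (α × β × γ) →L[ℂ] Hilb (α × β × γ) :=
  tensorId (thirdOfThree α β γ) (thirdOfThree α β γ) F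

theorem onThird_apply (F : Hilb γ →L[ℂ] Hilb γ) (ψ : Hilb (α × β × γ)) (a : α) (b : β) (c : γ) :
    onThird F ψ (a, b, c) = F (slice (thirdOfThree α β γ) (a, b) ψ) c := rfl

theorem tensorThree_isometry_inner (VA : Hilb α →ₗᵢ[ℂ] Hilb α') (VB : Hilb β →ₗᵢ[ℂ] Hilb β')
    (VE : Hilb γ →ₗᵢ[ℂ] Hilb γ') (ψ φ : Hilb (α × β × γ)) :
    inner ℂ (tensorThree VA.toContinuousLinearMap VB.toContinuousLinearMap
        VE.toContinuousLinearMap ψ)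
      (tensorThree VA.toContinuousLinearMap VB.toContinuousLinearMap
        VE.toContinuousLinearMap φ) = inner ℂ ψ φ := by
  simp only [tensorThree, ContinuousLinearMap.comp_apply]
  rw [inner_tensorId_isometry, inner_tensorId_isometry, inner_tensorId_isometry]

/-- An operator on the third system is carried along by a local isometry: it becomes the operator
`V₃ F V₃†` on the third system of the target. -/
theorem tensorThree_onThird (V₁ : Hilb α →L[ℂ] Hilb α') (V₂ : Hilb β →L[ℂ] Hilb β')
    (VE : Hilb γ →ₗᵢ[ℂ] Hilb γ') (F : Hilb γ →L[ℂ] Hilb γ) (ψ : Hilb (α × β × γ)) :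
    tensorThree V₁ V₂ VE.toContinuousLinearMap (onThird F ψ) =
      onThird (VE.toContinuousLinearMap ∘L F ∘L VE.toContinuousLinearMap.adjoint)
        (tensorThree V₁ V₂ VE.toContinuousLinearMap ψ) := by
  -- `s` and `t` put the operators in the form of `tensorId_comm`: `F` acts on the second
  -- factor, and `V₁`, respectively `V₂`, on the first.
  let s (α β γ : Type) : α × β × γ ≃ α × γ × β :=
    (Equiv.refl α).prodCongr (Equiv.prodComm β γ)
  let t (α β γ : Type) : α × β × γ ≃ β × γ × α := (secondOfThree α β γ).trans (s β α γ)
  have h₁ : onThird F ∘L tensorId (Equiv.refl (α × β × γ)) (Equiv.refl (α' × β × γ)) V₁ =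
      tensorId (Equiv.refl (α × β × γ)) (Equiv.refl (α' × β × γ)) V₁ ∘L onThird F := by
    have := tensorId_comm (s α β γ) (s α' β γ) (s α β γ) (s α' β γ) V₁ F
    rw [tensorId_congr (s α β γ) (s α' β γ) (Equiv.refl (α × β × γ)) (Equiv.refl (α' × β × γ)) V₁
      (fun _ => rfl) (fun _ _ => rfl)] at this
    exact this
  have h₂ : onThird F ∘L tensorId (secondOfThree α' β γ) (secondOfThree α' β' γ) V₂ =
      tensorId (secondOfThree α' β γ) (secondOfThree α' β' γ) V₂ ∘L onThird F := by
    have := tensorId_comm (t α' β γ) (t α' β' γ) (t α' β γ) (t α' β' γ) V₂ F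
    rw [tensorId_congr (t α' β γ) (t α' β' γ) (secondOfThree α' β γ) (secondOfThree α' β' γ) V₂
      (fun _ => rfl) (fun _ _ => rfl),
      tensorId_congr ((t α' β γ).trans (secondOfThree _ _ _))
        ((t α' β γ).trans (secondOfThree _ _ _)) (thirdOfThree α' β γ) (thirdOfThree α' β γ) F
      (fun _ => rfl) (fun _ _ => rfl),
      tensorId_congr ((t α' β' γ).trans (secondOfThree _ _ _))
        ((t α' β' γ).trans (secondOfThree _ _ _)) (thirdOfThree α' β' γ) (thirdOfThree α' β' γ) F
      (fun _ => rfl) (fun _ _ => rfl)] at this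
    exact this
  have h₃ : (VE.toContinuousLinearMap ∘L F ∘L VE.toContinuousLinearMap.adjoint) ∘L
      VE.toContinuousLinearMap = VE.toContinuousLinearMap ∘L F := by
    have : VE.toContinuousLinearMap.adjoint ∘L VE.toContinuousLinearMap = 1 :=
      (ContinuousLinearMap.norm_map_iff_adjoint_comp_self _).1 VE.norm_map
    rw [ContinuousLinearMap.comp_assoc, ContinuousLinearMap.comp_assoc, this]
    rfl
  simp only [tensorThree, ContinuousLinearMap.comp_apply]
  rw [← ContinuousLinearMap.comp_apply (tensorId (Equiv.refl _) (Equiv.refl _) V₁), ← h₁,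
    ContinuousLinearMap.comp_apply,
    ← ContinuousLinearMap.comp_apply (tensorId (secondOfThree _ _ _) _ V₂), ← h₂,
    ContinuousLinearMap.comp_apply]
  simp only [onThird]
  rw [← ContinuousLinearMap.comp_apply (tensorId _ _ VE.toContinuousLinearMap),
    ← ContinuousLinearMap.comp_apply (tensorId _ _ (_ ∘L _)), tensorId_comp, tensorId_comp, h₃]

/-- For a product `χ ⊗ ξ` of a two-party state and a junk state, the expectation value of an
operator acting on the junk of the third system factorises. -/
theorem inner_onThird_of_product {a b : Type} {v : Hilb ((a × α) × (b × β) × γ)}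
    {χ : Hilb (a × b)} {ξ : Hilb (α × β × γ)}
    (hv : ∀ q i q' j k, v ((q, i), (q', j), k) = χ (q, q') * ξ (i, j, k))
    (F : Hilb γ →L[ℂ] Hilb γ) :
    inner ℂ v (onThird F v) = (‖χ‖ ^ 2 : ℝ) * inner ℂ ξ (onThird F ξ) := by
  let e : (a × α) × (b × β) × γ ≃ (α × β × γ) × (a × b) :=
    { toFun := fun t => ((t.1.2, t.2.1.2, t.2.2), (t.1.1, t.2.1.1))
      invFun := fun t => ((t.2.1, t.1.1), (t.2.2, t.1.2.1), t.1.2.2) }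
  have h₁ (q : a × b) : slice e q v = χ q • ξ := by
    ext i
    exact hv _ _ _ _ _
  have h₂ (q : a × b) : slice e q (onThird F v) = χ q • onThird F ξ := by
    ext i
    have : slice (thirdOfThree (a × α) (b × β) γ) ((q.1, i.1), (q.2, i.2.1)) v =
        χ q • slice (thirdOfThree α β γ) (i.1, i.2.1) ξ := by
      ext k
      exact hv _ _ _ _ _
    change F (slice (thirdOfThree (a × α) (b × β) γ) ((q.1, i.1), (q.2, i.2.1)) v) i.2.2 =
      χ q * F (slice (thirdOfThree α β γ) (i.1, i.2.1) ξ) i.2.2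
    rw [this, map_smul]
    rfl
  rw [inner_eq_tsum_slice e, norm_sq_eq, Complex.ofReal_tsum, ← tsum_mul_right]
  refine tsum_congr fun q => ?_
  rw [h₁, h₂, inner_smul_left, inner_smul_right, ← mul_assoc, Complex.conj_mul']
  push_cast
  rfl

theorem expectation_pos_ne_zero {K : Type} {O : Hilb K →L[ℂ] Hilb K} {Φ : Hilb K}
    (h : 0 < expectation O Φ) : O Φ ≠ 0 := by
  intro h0
  simp [expectation, h0] at h

/-- If a self-testing inequality is saturated, the unnormalised state of the third system
conditioned on the outcomes `a, b` depends on them only through the scalar `‖(P_a ⊗ P_b) Φ‖²`. -/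
theorem exists_inner_onThird_eq {w : BellExpr} {η : ℝ} {Φ : Hilb (Fin 2 × Fin 2)}
    {PA PB : Measurements (Fin 2)} (h : SelfTests w η Φ PA PB) (S : BipartiteStrategy)
    (hS : S.bellValue w = η) :
    ∃ G : (Hilb S.ιE →L[ℂ] Hilb S.ιE) → ℂ, ∀ x y a b F,
      inner ℂ (S.opA x a (S.opB y b S.Ψ)) (onThird F (S.opA x a (S.opB y b S.Ψ))) =
        (‖onLeft (PA.P x a) (onRight (PB.P y b) Φ)‖ ^ 2 : ℝ) * G F := by
  obtain ⟨JA, JB, JE, VA, VB, VE, ξ, -, hξ⟩ := h S hS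
  refine ⟨fun F => inner ℂ ξ
    (onThird (VE.toContinuousLinearMap ∘L F ∘L VE.toContinuousLinearMap.adjoint) ξ),
    fun x y a b F => ?_⟩
  rw [← tensorThree_isometry_inner VA VB VE, tensorThree_onThird]
  exact inner_onThird_of_product (hξ x y a b) _

end SelfTest

/-! ### Ordered products of commuting factors -/

section ListProd

/-- A factor that commutes with all others can be moved to the front of an ordered product. -/
theorem prod_ofFn_update {R : Type*} [Monoid R] {n : ℕ} (k : Fin n) (x : R) (g : Fin n → R)
    (hx : ∀ j, j ≠ k → Commute x (g j)) :
    (List.ofFn (Function.update g k x)).prod = x * (List.ofFn (Function.update g k 1)).prod := by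
  induction n with
  | zero => exact k.elim0
  | succ n ih =>
    rw [List.ofFn_succ, List.ofFn_succ, List.prod_cons, List.prod_cons]
    cases k using Fin.cases with
    | zero => simp
    | succ k =>
      have h (y : R) : (fun i : Fin n => Function.update g k.succ y i.succ) =
          Function.update (fun i => g i.succ) k y := by
        ext i
        by_cases hi : i = k
        · subst hi; simp
        · simp [hi]
      rw [h, h, ih k _ fun j hj => hx _ (by simpa using hj),
        Function.update_of_ne (Fin.succ_ne_zero k).symm,
        Function.update_of_ne (Fin.succ_ne_zero k).symm, ← mul_assoc, ← mul_assoc,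
        (hx 0 (Fin.succ_ne_zero k).symm).eq]

theorem sum_prod_ofFn {R : Type*} [Semiring R] {n : ℕ} {β : Type*} [Fintype β]
    (f : Fin n → β → R) :
    ∑ a : Fin n → β, (List.ofFn fun j => f j (a j)).prod =
      (List.ofFn fun j => ∑ b, f j b).prod := by
  induction n with
  | zero => simp
  | succ n ih =>
    rw [List.ofFn_succ, List.prod_cons, ← ih, ← (Fin.consEquiv fun _ => β).sum_comp,
      Fintype.sum_prod_type, Finset.sum_mul]
    refine Finset.sum_congr rfl fun b _ => ?_
    rw [Finset.mul_sum]
    refine Finset.sum_congr rfl fun a _ => ?_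
    simp [Fin.consEquiv, List.ofFn_succ]

theorem isStarProjection_prod_ofFn {R : Type*} [Semiring R] [StarRing R] {n : ℕ} (f : Fin n → R)
    (hf : ∀ j, IsStarProjection (f j)) (hc : ∀ i j, i ≠ j → Commute (f i) (f j)) :
    IsStarProjection (List.ofFn f).prod := by
  induction n with
  | zero => simp
  | succ n ih =>
    rw [List.ofFn_succ, List.prod_cons]
    refine (hf 0).mul (ih _ (fun j => hf _) fun i j hij => hc _ _ (by simpa using hij)) ?_
    refine Commute.list_prod_right _ _ fun y hy => ?_
    obtain ⟨i, rfl⟩ := (List.mem_ofFn' _ _).1 hy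
    exact hc _ _ (Fin.succ_ne_zero i).symm

theorem commute_prod_ofFn {R : Type*} [Monoid R] {n : ℕ} {x : R} {f : Fin n → R}
    (h : ∀ j, Commute x (f j)) : Commute x (List.ofFn f).prod := by
  refine Commute.list_prod_right _ _ fun y hy => ?_
  obtain ⟨i, rfl⟩ := (List.mem_ofFn' _ _).1 hy
  exact h i

end ListProd

/-! ### Expectation values -/

section Expectation

variable {K : Type}

theorem expectation_sum {ι : Type*} (s : Finset ι) (O : ι → Hilb K →L[ℂ] Hilb K) (ψ : Hilb K) :
    expectation (∑ i ∈ s, O i) ψ = ∑ i ∈ s, expectation (O i) ψ := by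
  simp [expectation]

theorem expectation_natCast_smul (n : ℕ) (O : Hilb K →L[ℂ] Hilb K) (ψ : Hilb K) :
    expectation ((n : ℂ) • O) ψ = n * expectation O ψ := by
  simp [expectation]

theorem expectation_real_smul (c : ℝ) (O : Hilb K →L[ℂ] Hilb K) (ψ : Hilb K) :
    expectation O ((c : ℂ) • ψ) = c ^ 2 * expectation O ψ := by
  rw [expectation, map_smul, inner_smul_left, inner_smul_right, Complex.conj_ofReal,
    Complex.re_ofReal_mul, Complex.re_ofReal_mul, expectation]
  ring

/-- Compression by a projection that commutes with the operator. -/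
theorem inner_projection_mul {P O : Hilb K →L[ℂ] Hilb K} (hP : IsStarProjection P)
    (h : Commute P O) (ψ : Hilb K) : inner ℂ ψ ((P * O) ψ) = inner ℂ (P ψ) (O (P ψ)) := by
  have h1 : P * O = P * (O * P) := by
    rw [← h.eq, ← mul_assoc, hP.isIdempotentElem.eq]
  have h2 : inner ℂ ψ (star P (O (P ψ))) = inner ℂ (P ψ) (O (P ψ)) :=
    ContinuousLinearMap.adjoint_inner_right P ψ _
  rw [hP.isSelfAdjoint.star_eq] at h2
  rw [h1]
  exact h2

theorem expectation_projection_mul {P O : Hilb K →L[ℂ] Hilb K} (hP : IsStarProjection P)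
    (h : Commute P O) (ψ : Hilb K) : expectation (P * O) ψ = expectation O (P ψ) := by
  rw [expectation, inner_projection_mul hP h, expectation]

theorem expectation_projection {P : Hilb K →L[ℂ] Hilb K} (hP : IsStarProjection P)
    (ψ : Hilb K) : expectation P ψ = ‖P ψ‖ ^ 2 := by
  have := expectation_projection_mul hP (Commute.one_right P) ψ
  rw [mul_one] at this
  rw [this, expectation]
  exact (norm_sq_eq_re_inner (𝕜 := ℂ) _).symm

end Expectation

theorem commute_op {K : Type} (w : BellExpr) {A B : Fin 2 → Fin 2 → (Hilb K →L[ℂ] Hilb K)}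
    {P : Hilb K →L[ℂ] Hilb K} (hA : ∀ x a, Commute P (A x a)) (hB : ∀ y b, Commute P (B y b)) :
    Commute P (w.op A B) :=
  Commute.sum_right _ _ _ fun x _ => Commute.sum_right _ _ _ fun y _ =>
    Commute.sum_right _ _ _ fun a _ => Commute.sum_right _ _ _ fun b _ =>
      ((hA x a).mul_right (hB y b)).smul_right _

/-! ### Operators of the parties -/

namespace Strategy

variable {N : ℕ} (S : Strategy N)

/-- Singling out the tensor factors of the two parties `k` and `l`; the remaining devices and Eve
form the third factor. -/
def splitTwo {k l : Fin N} (h : k ≠ l) : (∀ j, S.ι j) × S.ιE ≃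
    S.ι k × S.ι l × ((∀ j : {j : Fin N // j ≠ k ∧ j ≠ l}, S.ι j) × S.ιE) where
  toFun t := (t.1 k, t.1 l, (fun j => t.1 j, t.2))
  invFun t := (fun j => if hk : j = k then hk.symm.rec t.1 else
    if hl : j = l then hl.symm.rec t.2.1 else t.2.2.1 ⟨j, hk, hl⟩, t.2.2.2)
  left_inv t := by
    refine Prod.ext (funext fun j => ?_) rfl
    by_cases hk : j = k
    · subst hk; simp
    · by_cases hl : j = l
      · subst hl; simp [hk]
      · simp [hk, hl]
  right_inv t := by
    obtain ⟨i, j, f, e⟩ := t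
    have : (fun j : {j : Fin N // j ≠ k ∧ j ≠ l} => f ⟨j, j.2.1, j.2.2⟩) = f := rfl
    simp only [dif_pos, h.symm, dif_neg, not_false_eq_true, Prod.mk.injEq, true_and, and_true]
    funext m
    simp [m.2.1, m.2.2]

theorem op_eq_splitTwo_left {k l : Fin N} (h : k ≠ l) (x a : Fin 2) :
    S.op k x a = tensorId (S.splitTwo h) (S.splitTwo h) ((S.meas k).P x a) := by
  refine tensorId_congr _ _ _ _ _ (fun _ => rfl) fun t i => ?_
  refine Prod.ext (funext fun j => ?_) rfl
  by_cases hk : j = k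
  · subst hk; simp [split, splitTwo]
  · by_cases hl : j = l
    · subst hl; simp [split, splitTwo, hk]
    · simp [split, splitTwo, hk, hl]

theorem op_eq_splitTwo_right {k l : Fin N} (h : k ≠ l) (x a : Fin 2) :
    S.op l x a = tensorId ((S.splitTwo h).trans (secondOfThree _ _ _))
      ((S.splitTwo h).trans (secondOfThree _ _ _)) ((S.meas l).P x a) := by
  refine tensorId_congr _ _ _ _ _ (fun _ => rfl) fun t i => ?_
  refine Prod.ext (funext fun j => ?_) rfl
  by_cases hk : j = k
  · subst hk; simp [split, splitTwo, secondOfThree, h]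
  · by_cases hl : j = l
    · subst hl; simp [split, splitTwo, secondOfThree, hk]
    · simp [split, splitTwo, secondOfThree, hk, hl]

theorem commute_op_op {k l : Fin N} (h : k ≠ l) (x a y b : Fin 2) :
    Commute (S.op k x a) (S.op l y b) := by
  rw [S.op_eq_splitTwo_left h, S.op_eq_splitTwo_right h]
  exact (tensorId_comm (S.splitTwo h) (S.splitTwo h) (S.splitTwo h) (S.splitTwo h) _ _).symm

theorem commute_onRight_op (F : Hilb S.ιE →L[ℂ] Hilb S.ιE) (k : Fin N) (x a : Fin 2) :
    Commute (onRight F : S.Space →L[ℂ] S.Space) (S.op k x a) := by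
  let g := (S.split k).trans ((Equiv.refl _).prodCongr (Equiv.prodComm _ _))
  have h₁ : S.op k x a = tensorId g g ((S.meas k).P x a) :=
    tensorId_congr _ _ _ _ _ (fun _ => rfl) (fun _ _ => rfl)
  have h₂ : (onRight F : S.Space →L[ℂ] S.Space) =
      tensorId (g.trans (secondOfThree _ _ _)) (g.trans (secondOfThree _ _ _)) F := by
    refine tensorId_congr _ _ _ _ _ (fun _ => rfl) fun t i => ?_
    refine Prod.ext (funext fun j => ?_) rfl
    by_cases hk : j = k
    · subst hk; simp [g, split, secondOfThree]
    · simp [g, split, secondOfThree, hk]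
  rw [h₁, h₂]
  exact tensorId_comm g g g g _ _

theorem isStarProjection_op (k : Fin N) (x a : Fin 2) : IsStarProjection (S.op k x a) :=
  isStarProjection_tensorId _ ((S.meas k).isProj x a)

theorem sum_op (k : Fin N) (x : Fin 2) : ∑ a, S.op k x a = 1 := by
  have h := (S.meas k).sum_eq_one x
  rw [Fin.sum_univ_two] at h ⊢
  rw [op, op, ← tensorId_add, h, tensorId_one]

theorem isStarProjection_jointProj (x a : Fin N → Fin 2) : IsStarProjection (S.jointProj x a) :=
  isStarProjection_prod_ofFn _ (fun _ => S.isStarProjection_op _ _ _)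
    fun _ _ h => S.commute_op_op h _ _ _ _

theorem commute_onRight_jointProj (F : Hilb S.ιE →L[ℂ] Hilb S.ιE) (x a : Fin N → Fin 2) :
    Commute (onRight F : S.Space →L[ℂ] S.Space) (S.jointProj x a) :=
  commute_prod_ofFn fun _ => S.commute_onRight_op _ _ _ _

theorem sum_jointProj (x : Fin N → Fin 2) : ∑ a, S.jointProj x a = 1 := by
  have := sum_prod_ofFn fun j => S.op j (x j)
  simp only [jointProj, this, sum_op]
  simp

theorem isStarProjection_otherProj (k l : Fin N) (μ : OtherOutcomes k l) :
    IsStarProjection (S.otherProj k l μ) := by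
  refine isStarProjection_prod_ofFn _ (fun j => ?_) fun i j h => ?_
  · split_ifs
    · exact S.isStarProjection_op _ _ _
    · exact .one _
  · split_ifs
    · exact S.commute_op_op h _ _ _ _
    all_goals simp

theorem commute_otherProj_op_left (k l : Fin N) (μ : OtherOutcomes k l) (x a : Fin 2) :
    Commute (S.otherProj k l μ) (S.op k x a) := by
  refine (commute_prod_ofFn fun j => ?_).symm
  split_ifs with h
  · exact S.commute_op_op h.1.symm _ _ _ _
  · exact Commute.one_right _

theorem commute_otherProj_op_right (k l : Fin N) (μ : OtherOutcomes k l) (x a : Fin 2) :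
    Commute (S.otherProj k l μ) (S.op l x a) := by
  refine (commute_prod_ofFn fun j => ?_).symm
  split_ifs with h
  · exact S.commute_op_op h.2.symm _ _ _ _
  · exact Commute.one_right _

theorem jointProj_zero_eq {k l : Fin N} (h : k ≠ l) (a : Fin N → Fin 2) :
    S.jointProj 0 a = S.op k 0 (a k) * S.op l 0 (a l) * S.otherProj k l fun j => a j := by
  let g : Fin N → (S.Space →L[ℂ] S.Space) := fun j => S.op j 0 (a j)
  have h₁ : S.jointProj 0 a = (List.ofFn (Function.update g k (g k))).prod := by
    rw [Function.update_eq_self]; rfl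
  have h₂ : Function.update g k 1 =
      Function.update (Function.update g k 1) l (g l) := by
    ext1 j
    by_cases hj : j = l
    · subst hj; simp [h.symm]
    · simp [hj]
  rw [h₁, prod_ofFn_update _ _ _ fun j hj => S.commute_op_op hj.symm _ _ _ _, h₂,
    prod_ofFn_update, mul_assoc]
  · congr 4
    ext1 j
    by_cases hl : j = l
    · subst hl; simp
    · by_cases hk : j = k
      · subst hk; simp [hl]
      · simp [hk, hl, g]
  · intro j hj
    by_cases hk : j = k
    · subst hk; simp
    · simpa [hk] using S.commute_op_op (Ne.symm hj) _ _ _ _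

/-- Outcome strings, written as the outcomes of `k` and `l` and those of the other parties. -/
def outcomesSplitTwo {k l : Fin N} (h : k ≠ l) :
    Fin 2 × Fin 2 × OtherOutcomes k l ≃ (Fin N → Fin 2) where
  invFun a := (a k, a l, fun j => a j)
  toFun t j := if hk : j = k then t.1 else if hl : j = l then t.2.1 else t.2.2 ⟨j, hk, hl⟩
  right_inv a := by
    ext1 j
    by_cases hk : j = k
    · subst hk; simp
    · by_cases hl : j = l
      · subst hl; simp [hk]
      · simp [hk, hl]
  left_inv t := by
    obtain ⟨i, j, f⟩ := t
    simp only [dif_pos, h.symm, dif_neg, not_false_eq_true, Prod.mk.injEq, true_and]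
    funext m
    simp [m.2.1, m.2.2]

theorem sum_otherProj {k l : Fin N} (h : k ≠ l) : ∑ μ, S.otherProj k l μ = 1 := by
  have h₁ (t : Fin 2 × Fin 2 × OtherOutcomes k l) : S.jointProj 0 (outcomesSplitTwo h t) =
      S.op k 0 t.1 * S.op l 0 t.2.1 * S.otherProj k l t.2.2 := by
    have h₂ := (outcomesSplitTwo h).symm_apply_apply t
    rw [S.jointProj_zero_eq h]
    conv_rhs => rw [← h₂]
    rfl
  have := S.sum_jointProj 0
  rw [← (outcomesSplitTwo h).sum_comp] at this
  simp only [h₁, Fintype.sum_prod_type, ← Finset.mul_sum, ← Finset.sum_mul, sum_op] at this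
  simpa using this

theorem sum_norm_otherProj {k l : Fin N} (h : k ≠ l) :
    ∑ μ, ‖S.otherProj k l μ S.Ψ‖ ^ 2 = 1 := by
  simp only [← expectation_projection (S.isStarProjection_otherProj k l _), ← expectation_sum,
    S.sum_otherProj h]
  have := norm_sq_eq_re_inner (𝕜 := ℂ) S.Ψ
  rw [S.norm_eq_one, one_pow] at this
  exact this.symm

end Strategy

/-- A map that intertwines the projectors of both parties intertwines the Bell operators. -/
theorem op_intertwine {K L : Type} (w : BellExpr) {A B : Fin 2 → Fin 2 → (Hilb K →L[ℂ] Hilb K)}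
    {A' B' : Fin 2 → Fin 2 → (Hilb L →L[ℂ] Hilb L)} (U : Hilb K →L[ℂ] Hilb L)
    (hA : ∀ x a ψ, A' x a (U ψ) = U (A x a ψ)) (hB : ∀ y b ψ, B' y b (U ψ) = U (B y b ψ))
    (ψ : Hilb K) : w.op A' B' (U ψ) = U (w.op A B ψ) := by
  have h (x y a b : Fin 2) : (A' x a * B' y b) (U ψ) = U ((A x a * B y b) ψ) := by
    change A' x a (B' y b (U ψ)) = U (A x a (B y b ψ))
    rw [hB, hA]
  simp only [BellExpr.op, sum_apply, map_sum, smul_apply, map_smul, h]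

theorem norm_inv_norm_smul {E : Type*} [NormedAddCommGroup E] [NormedSpace ℂ E] {φ : E}
    (h0 : φ ≠ 0) :
    ‖((‖φ‖⁻¹ : ℝ) : ℂ) • φ‖ = 1 := by
  rw [norm_smul, Complex.norm_real, norm_inv, norm_norm, inv_mul_cancel₀ (norm_ne_zero_iff.2 h0)]

namespace Strategy

variable {N : ℕ} (S : Strategy N)

/-! ### The bipartite strategies of pairs of parties -/

/-- The bipartite strategy in which parties `k` and `l` measure the state `φ`, all other devices
being handed to the purifying system together with Eve. -/
def pair {k l : Fin N} (h : k ≠ l) (φ : S.Space) (hφ : ‖φ‖ = 1) : BipartiteStrategy where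
  ιA := S.ι k
  ιB := S.ι l
  ιE := (∀ j : {j : Fin N // j ≠ k ∧ j ≠ l}, S.ι j) × S.ιE
  A := S.meas k
  B := S.meas l
  Ψ := reindex (S.splitTwo h) φ
  norm_eq_one := by rw [norm_reindex, hφ]

section Pair

variable {S} {k l : Fin N} (h : k ≠ l) (φ : S.Space) (hφ : ‖φ‖ = 1)

theorem pair_opA_reindex (x a : Fin 2) (ψ : S.Space) :
    (S.pair h φ hφ).opA x a (reindex (S.splitTwo h) ψ) =
      reindex (S.splitTwo h) (S.op k x a ψ) := by
  rw [S.op_eq_splitTwo_left h, reindex_tensorId, Equiv.symm_trans_self]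
  rfl

theorem pair_opB_reindex (x a : Fin 2) (ψ : S.Space) :
    (S.pair h φ hφ).opB x a (reindex (S.splitTwo h) ψ) =
      reindex (S.splitTwo h) (S.op l x a ψ) := by
  rw [S.op_eq_splitTwo_right h, reindex_tensorId, ← Equiv.trans_assoc, Equiv.symm_trans_self,
    Equiv.refl_trans]
  rfl

theorem pair_bellValue (w : BellExpr) :
    (S.pair h φ hφ).bellValue w = expectation (w.op (S.op k) (S.op l)) φ := by
  have : (S.pair h φ hφ).bellOp w (S.pair h φ hφ).Ψ =
      reindex (S.splitTwo h) (w.op (S.op k) (S.op l) φ) := by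
    exact op_intertwine w (reindex (S.splitTwo h)) (pair_opA_reindex h φ hφ)
      (pair_opB_reindex h φ hφ) φ
  rw [BipartiteStrategy.bellValue, expectation, this, expectation]
  exact congrArg Complex.re (inner_reindex (S.splitTwo h) φ _)

theorem onThird_reindex (F : Hilb S.ιE →L[ℂ] Hilb S.ιE) (ψ : S.Space) :
    onThird (onRight F) (reindex (S.splitTwo h) ψ) =
      reindex (S.splitTwo h) ((onRight F : S.Space →L[ℂ] S.Space) ψ) := by
  ext ⟨i, j, f, e⟩
  rw [onThird_apply]
  rfl

theorem inner_onThird_reindex (F : Hilb S.ιE →L[ℂ] Hilb S.ιE) (ψ : S.Space) :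
    inner ℂ (reindex (S.splitTwo h) ψ) (onThird (onRight F) (reindex (S.splitTwo h) ψ)) =
      inner ℂ ψ ((onRight F : S.Space →L[ℂ] S.Space) ψ) := by
  rw [onThird_reindex, inner_reindex]

end Pair

/-- A bipartite bound holds for any two of the `N` parties, in every state: the normalised state is
a state of the two parties, purified by everybody else. -/
theorem expectation_bell_le {k l : Fin N} (h : k ≠ l) {w : BellExpr} {η : ℝ}
    (hw : IsMaxQuantumValue w η) (φ : S.Space) :
    expectation (w.op (S.op k) (S.op l)) φ ≤ η * ‖φ‖ ^ 2 := by
  by_cases h0 : φ = 0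
  · subst h0; simp [expectation]
  have h₁ := hw.2 ⟨S.pair h _ (norm_inv_norm_smul h0), rfl⟩
  simp only [pair_bellValue, expectation_real_smul] at h₁
  have h₂ : 0 < ‖φ‖ := norm_pos_iff.2 h0
  rwa [inv_pow, inv_mul_le_iff₀ (by positivity), mul_comm] at h₁

/-- If the expanded Bell expression attains its bound, then so does every seed, in the state of
the system after the other parties have found the outcomes `μ`. -/
theorem expectation_seed_eq (X : ExpandedBell N) (hS : S.bellValue X = X.ηN) {k l : Fin N}
    (hkl : X.C k l ≠ 0) (μ : OtherOutcomes k l) :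
    expectation ((X.seed k l μ).op (S.op k) (S.op l)) (S.otherProj k l μ S.Ψ) =
      X.ηQ * ‖S.otherProj k l μ S.Ψ‖ ^ 2 := by
  have hne {k l : Fin N} (h : X.C k l ≠ 0) : k ≠ l := by
    rintro rfl
    exact h (X.C_eq_zero _ _ (lt_irrefl _))
  let d (k l : Fin N) (μ : OtherOutcomes k l) : ℝ := X.ηQ * ‖S.otherProj k l μ S.Ψ‖ ^ 2 -
    expectation ((X.seed k l μ).op (S.op k) (S.op l)) (S.otherProj k l μ S.Ψ)
  have hd {k l : Fin N} (h : X.C k l ≠ 0) (μ : OtherOutcomes k l) : 0 ≤ d k l μ :=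
    sub_nonneg.2 (S.expectation_bell_le (hne h) (X.quantumBound k l h μ) _)
  -- The total deficit is a sum of nonnegative terms, and it vanishes as `∑ μ, ‖P_μ Ψ‖² = 1`.
  have h0 (k l : Fin N) : 0 ≤ (X.C k l : ℝ) * ∑ μ, d k l μ := by
    by_cases h : X.C k l = 0
    · simp [h]
    · exact mul_nonneg (Nat.cast_nonneg _) (Finset.sum_nonneg fun μ _ => hd h μ)
  have hsum : ∑ k, ∑ l, (X.C k l : ℝ) * ∑ μ, d k l μ = 0 := by
    rw [bellValue, bellOp, ExpandedBell.ηN, ← sub_eq_zero] at hS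
    simp only [expectation_sum, expectation_natCast_smul] at hS
    rw [← neg_eq_zero, ← hS, neg_eq_iff_eq_neg, neg_sub, ← Finset.sum_sub_distrib]
    refine Finset.sum_congr rfl fun k _ => ?_
    rw [← Finset.sum_sub_distrib]
    refine Finset.sum_congr rfl fun l _ => ?_
    by_cases h : X.C k l = 0
    · simp [h]
    rw [← mul_sub, Finset.sum_sub_distrib, ← Finset.mul_sum, S.sum_norm_otherProj (hne h), mul_one]
    congr 2
    refine Finset.sum_congr rfl fun μ _ => ?_
    rw [expectation_projection_mul (S.isStarProjection_otherProj k l μ)]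
    exact commute_op _ (S.commute_otherProj_op_left k l μ) (S.commute_otherProj_op_right k l μ)
  have h₁ := (Finset.sum_eq_zero_iff_of_nonneg fun k _ => Finset.sum_nonneg fun l _ => h0 k l).1
    hsum k (Finset.mem_univ _)
  have h₂ := (Finset.sum_eq_zero_iff_of_nonneg fun l _ => h0 k l).1 h₁ l (Finset.mem_univ _)
  have h₃ := (mul_eq_zero.1 h₂).resolve_left (Nat.cast_ne_zero.2 hkl)
  have h₄ := (Finset.sum_eq_zero_iff_of_nonneg fun μ _ => hd hkl μ).1 h₃ μ (Finset.mem_univ _)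
  exact (sub_eq_zero.1 h₄).symm

/-! ### Eve's conditional states are proportional -/

/-- Eve's unnormalised states for the outcome strings `a` and `a'` (all inputs being `0`) agree up
to a positive factor. The states are given by the values they assign to operators on Eve's
system. -/
def EveProportional (a a' : Fin N → Fin 2) : Prop :=
  ∃ c : ℝ, 0 < c ∧ ∀ F : Hilb S.ιE →L[ℂ] Hilb S.ιE,
    inner ℂ S.Ψ (onRight F (S.jointProj 0 a' S.Ψ)) =
      c * inner ℂ S.Ψ (onRight F (S.jointProj 0 a S.Ψ))

theorem EveProportional.refl (a : Fin N → Fin 2) : S.EveProportional a a :=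
  ⟨1, one_pos, fun F => by simp⟩

variable {S} in
theorem EveProportional.trans {a b c : Fin N → Fin 2} (h : S.EveProportional a b)
    (h' : S.EveProportional b c) : S.EveProportional a c := by
  obtain ⟨s, hs, h⟩ := h
  obtain ⟨t, ht, h'⟩ := h'
  refine ⟨t * s, mul_pos ht hs, fun F => ?_⟩
  rw [h', h, Complex.ofReal_mul, mul_assoc]

/-- The projection onto an outcome string may be applied on both sides, since it commutes with Eve's
operators. -/
theorem inner_onRight_jointProj (F : Hilb S.ιE →L[ℂ] Hilb S.ιE) (x a : Fin N → Fin 2) :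
    inner ℂ S.Ψ (onRight F (S.jointProj x a S.Ψ)) =
      inner ℂ (S.jointProj x a S.Ψ) (onRight F (S.jointProj x a S.Ψ)) := by
  have h := S.commute_onRight_jointProj F x a
  rw [← inner_projection_mul (S.isStarProjection_jointProj x a) h.symm, ← h.eq]
  rfl

/-- If a seed of the pair `k, l` is saturated after the outcomes of the other parties, then the
outcomes of `k` and `l` may be changed at will without affecting Eve's normalised state. -/
theorem eveProportional_of_selfTests {k l : Fin N} (h : k ≠ l) (a a' : Fin N → Fin 2)
    (haa' : ∀ j, j ≠ k ∧ j ≠ l → a j = a' j) {w : BellExpr} {η : ℝ} {Φ : Hilb (Fin 2 × Fin 2)}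
    {PA PB : Measurements (Fin 2)} (hst : SelfTests w η Φ PA PB)
    (hpos : ∀ a b, 0 < expectation (onLeft (PA.P 0 a) * onRight (PB.P 0 b)) Φ)
    (hval : expectation (w.op (S.op k) (S.op l)) (S.otherProj k l (fun j => a j) S.Ψ) =
      η * ‖S.otherProj k l (fun j => a j) S.Ψ‖ ^ 2) : S.EveProportional a a' := by
  set φ := S.otherProj k l (fun j => a j) S.Ψ with hφ
  have hJ : S.jointProj 0 a S.Ψ = S.op k 0 (a k) (S.op l 0 (a l) φ) := by
    rw [S.jointProj_zero_eq h]; rfl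
  have hJ' : S.jointProj 0 a' S.Ψ = S.op k 0 (a' k) (S.op l 0 (a' l) φ) := by
    rw [S.jointProj_zero_eq h, hφ, show (fun j : {j : Fin N // j ≠ k ∧ j ≠ l} => a j.1) =
      fun j => a' j.1 from funext fun j => haa' j j.2]
    rfl
  -- If the outcomes of the other parties never occur, both states vanish.
  by_cases h0 : φ = 0
  · refine ⟨1, one_pos, fun F => ?_⟩
    simp [hJ, hJ', h0]
  have hφ0 : ‖φ‖ ≠ 0 := norm_ne_zero_iff.2 h0
  let r : ℂ := ((‖φ‖⁻¹ : ℝ) : ℂ)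
  have hr : r ≠ 0 := Complex.ofReal_ne_zero.2 (inv_ne_zero hφ0)
  have hsat : (S.pair h (r • φ) (norm_inv_norm_smul h0)).bellValue w = η := by
    rw [pair_bellValue, expectation_real_smul, hval]
    field_simp
  obtain ⟨G, hG⟩ := exists_inner_onThird_eq hst _ hsat
  have key (b c : Fin 2) (F : Hilb S.ιE →L[ℂ] Hilb S.ιE) :
      (starRingEnd ℂ r * r) * inner ℂ (S.op k 0 b (S.op l 0 c φ))
        ((onRight F : S.Space →L[ℂ] S.Space) (S.op k 0 b (S.op l 0 c φ))) =
      (‖onLeft (PA.P 0 b) (onRight (PB.P 0 c) Φ)‖ ^ 2 : ℝ) * G (onRight F) := by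
    have e : (S.pair h (r • φ) (norm_inv_norm_smul h0)).opA 0 b
        ((S.pair h (r • φ) (norm_inv_norm_smul h0)).opB 0 c
          (S.pair h (r • φ) (norm_inv_norm_smul h0)).Ψ) =
        reindex (S.splitTwo h) (r • S.op k 0 b (S.op l 0 c φ)) := by
      change (S.pair h (r • φ) (norm_inv_norm_smul h0)).opA 0 b
        ((S.pair h (r • φ) (norm_inv_norm_smul h0)).opB 0 c (reindex (S.splitTwo h) (r • φ))) = _
      rw [pair_opB_reindex, pair_opA_reindex, map_smul, map_smul]
    have h₁ := hG 0 0 b c (onRight F)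
    rw [e] at h₁
    refine Eq.trans ?_ ((inner_onThird_reindex h F _).symm.trans h₁)
    rw [map_smul, inner_smul_left, inner_smul_right, mul_assoc]
  have hp (b c : Fin 2) : 0 < ‖onLeft (PA.P 0 b) (onRight (PB.P 0 c) Φ)‖ ^ 2 :=
    pow_pos (norm_pos_iff.2 (expectation_pos_ne_zero (hpos b c))) 2
  refine ⟨_, div_pos (hp (a' k) (a' l)) (hp (a k) (a l)), fun F => ?_⟩
  have hq : starRingEnd ℂ r * r ≠ 0 := mul_ne_zero ((map_ne_zero _).2 hr) hr
  rw [inner_onRight_jointProj, inner_onRight_jointProj, hJ, hJ']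
  refine mul_left_cancel₀ hq ?_
  rw [key, mul_left_comm, key, ← mul_assoc, ← Complex.ofReal_mul,
    div_mul_cancel₀ _ (hp (a k) (a l)).ne']

/-- It suffices to change one outcome at a time. -/
theorem eveProportional_of_update
    (h : ∀ (a : Fin N → Fin 2) (j : Fin N) (v : Fin 2), S.EveProportional a (Function.update a j v))
    (a a' : Fin N → Fin 2) : S.EveProportional a a' := by
  have (s : Finset (Fin N)) : S.EveProportional a (s.piecewise a' a) := by
    induction s using Finset.induction_on with
    | empty => simpa using EveProportional.refl S a
    | insert j s _ ih =>
      rw [Finset.piecewise_insert]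
      exact ih.trans (h _ _ _)
  simpa using this Finset.univ

/-! ### Post-measurement states -/

/-- The operator `|e'⟩⟨e|`, whose expectation value is the entry `(e, e')` of a density matrix. -/
def matrixUnit {κ : Type} (e' e : κ) : Hilb κ →L[ℂ] Hilb κ :=
  open Classical in
  (innerSL ℂ (lp.single 2 e (1 : ℂ) : Hilb κ)).smulRight (lp.single 2 e' (1 : ℂ) : Hilb κ)

theorem inner_matrixUnit {κ : Type} (e' e : κ) (v w : Hilb κ) :
    inner ℂ v (matrixUnit e' e w) = w e * star (v e') := by
  classical
  have h : inner ℂ (lp.single 2 e (1 : ℂ) : Hilb κ) w = w e := by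
    rw [lp.inner_single_left]; simp
  have h' : inner ℂ v (lp.single 2 e' (1 : ℂ) : Hilb κ) = star (v e') := by
    rw [lp.inner_single_right]; simp
  have : matrixUnit e' e w =
      inner ℂ (lp.single 2 e (1 : ℂ) : Hilb κ) w • lp.single 2 e' (1 : ℂ) := by
    simp only [matrixUnit, ContinuousLinearMap.smulRight_apply, innerSL_apply_apply]
  rw [this, inner_smul_right, h, h']

theorem traceLeft_ketBra {ι κ : Type} (φ ψ : Hilb (ι × κ)) (e e' : κ) :
    traceLeft (ketBra φ ψ) e e' = inner ℂ ψ (onRight (matrixUnit e' e) φ) := by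
  rw [inner_eq_tsum_slice (Equiv.prodComm ι κ)]
  refine tsum_congr fun q => ?_
  rw [onRight, slice_tensorId, inner_matrixUnit]
  rfl

theorem rhoEve_apply (a x : Fin N → Fin 2) (e e' : S.ιE) :
    S.rhoEve a x e e' = inner ℂ S.Ψ (onRight (matrixUnit e' e) (S.jointProj x a S.Ψ)) :=
  traceLeft_ketBra _ _ _ _

theorem sum_rhoEve (x : Fin N → Fin 2) (e e' : S.ιE) : ∑ a, S.rhoEve a x e e' = S.rhoE e e' := by
  simp only [rhoEve_apply]
  rw [← inner_sum, ← map_sum, ← sum_apply, sum_jointProj]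
  exact (traceLeft_ketBra _ _ _ _).symm

theorem tsum_rhoE_diag : ∑' e, S.rhoE e e = 1 := by
  have h : inner ℂ S.Ψ S.Ψ = (1 : ℂ) := by
    rw [inner_self_eq_norm_sq_to_K, S.norm_eq_one]; simp
  rw [← h, inner_eq_tsum_slice (Equiv.refl _)]
  refine tsum_congr fun e => ?_
  rw [lp.inner_eq_tsum]
  rfl

theorem rhoRE_apply (x a a' : Fin N → Fin 2) (e e' : S.ιE) :
    S.rhoRE x (a, e) (a', e') = if a = a' then S.rhoEve a x e e' else 0 := by
  rw [rhoRE, Matrix.sum_apply]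
  simp only [Matrix.kroneckerMap_apply, Matrix.single_apply, ite_mul, one_mul, zero_mul]
  split_ifs with h
  · subst h; simp
  · exact Finset.sum_eq_zero fun b _ => if_neg fun hb => h (hb.1.symm.trans hb.2)

/-- If all of Eve's conditional states are proportional, the outcomes are uncorrelated with her. -/
theorem rhoRE_eq_of_eveProportional (h : ∀ a a', S.EveProportional a a') :
    S.rhoRE 0 = S.rhoR 0 ⊗ₖ S.rhoE := by
  choose c hc h using h 0
  have h₁ (a : Fin N → Fin 2) (e e' : S.ιE) :
      S.rhoEve a 0 e e' = c a * S.rhoEve 0 0 e e' := by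
    rw [rhoEve_apply, rhoEve_apply, h]
  have hpos : 0 < ∑ a, c a := Finset.sum_pos (fun a _ => hc a) Finset.univ_nonempty
  have h₂ (e e' : S.ιE) : S.rhoE e e' = (∑ a, c a : ℝ) * S.rhoEve 0 0 e e' := by
    rw [← S.sum_rhoEve 0, Complex.ofReal_sum, Finset.sum_mul]
    exact Finset.sum_congr rfl fun a _ => h₁ a e e'
  have h₃ (a : Fin N → Fin 2) (e e' : S.ιE) :
      S.rhoEve a 0 e e' = (c a / ∑ a, c a : ℝ) * S.rhoE e e' := by
    rw [h₁, h₂, ← mul_assoc, ← Complex.ofReal_mul, div_mul_cancel₀ _ hpos.ne']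
  have h₄ (a a' : Fin N → Fin 2) :
      S.rhoR 0 a a' = if a = a' then ((c a / ∑ a, c a : ℝ) : ℂ) else 0 := by
    simp only [rhoR, traceRight, rhoRE_apply]
    split_ifs with ha
    · simp only [h₃, tsum_mul_left, tsum_rhoE_diag, mul_one]
    · exact tsum_zero
  ext ⟨a, e⟩ ⟨a', e'⟩
  rw [Matrix.kroneckerMap_apply, h₄, rhoRE_apply]
  split_ifs
  · exact h₃ a e e'
  · rw [zero_mul]

end Strategy

end DIBell

end

theorem lemma2 (N : ℕ) (X : ExpandedBell N)
    (hC : ∀ k l : Fin N, X.C k l = if k < l ∧ (l : ℕ) + 1 = N then 1 else 0)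
    (Φ : Hilb (Fin 2 × Fin 2)) (hΦ : ‖Φ‖ = 1) (hent : IsEntangled Φ)
    (hseed : ∀ k l : Fin N, X.C k l = 1 → ∀ μ : OtherOutcomes k l,
      AdmitsSOS (X.seed k l μ) X.ηQ ∧
      ∃ Pk PN : Measurements (Fin 2),
        SelfTests (X.seed k l μ) X.ηQ Φ Pk PN ∧
        ∀ a b : Fin 2, 0 < expectation (onLeft (Pk.P 0 a) * onRight (PN.P 0 b)) Φ)
    (S : Strategy N) (hS : S.bellValue X = X.ηN) :
    S.rhoRE 0 = S.rhoR 0 ⊗ₖ S.rhoE := by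
  -- Any two outcome strings that differ at most at `k` and the last party are linked.
  have hlink (k l : Fin N) (hkl : k < l) (hl : (l : ℕ) + 1 = N) (a a' : Fin N → Fin 2)
      (h : ∀ j, j ≠ k ∧ j ≠ l → a j = a' j) : S.EveProportional a a' := by
    have hC1 : X.C k l = 1 := by rw [hC, if_pos ⟨hkl, hl⟩]
    obtain ⟨-, Pk, PN, hst, hpos⟩ := hseed k l hC1 fun j => a j
    exact S.eveProportional_of_selfTests hkl.ne a a' h hst hpos
      (S.expectation_seed_eq X hS (by simp [hC1]) _)
  -- `C ≠ 0` provides a party other than the last one, hence a link that changes the last outcome.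
  obtain ⟨k₀, l, h₀⟩ : ∃ k l, X.C k l ≠ 0 := by
    by_contra! h
    exact X.C_ne_zero (Matrix.ext h)
  obtain ⟨hk₀, hl⟩ : k₀ < l ∧ (l : ℕ) + 1 = N := by
    by_contra h
    exact h₀ (by rw [hC, if_neg h])
  refine S.rhoRE_eq_of_eveProportional (S.eveProportional_of_update fun a j v => ?_)
  by_cases hj : j = l
  · subst hj
    exact hlink k₀ j hk₀ hl _ _ fun i hi => (Function.update_of_ne hi.2 _ _).symm
  · have : j < l := by
      rw [Fin.lt_def]; have := j.isLt; have := Fin.val_ne_of_ne hj; omega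
    exact hlink j l this hl _ _ fun i hi => (Function.update_of_ne hi.1 _ _).symm
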